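/- \textbf{Setting.} A \emph{long singular knot} is represented by a diagram in the plane: an oriented immersed line running from left to right whose only vertices are classical crossings and (rigid) double points. Two diagrams represent isotopic long singular knots iff they are related by planar isotopy and finitely many of the following moves: the ordinary Reidemeister moves, the move $SII$ (half a turn of a double point carries a crossing of its two strands, with its sign, from one side of the double point to the opposite side), and the move $SIII$ (a strand is moved over, or under, a double point). Connected planar diagrams are encoded by their planar Gauss codes. The double points $p_1,p_2,\dots$ are numbered in the order of their first passage. The \emph{inverse} $-K$ is obtained by turning $K$ by half a turn about a vertical line in the plane of the diagram (so that the endpoints are interchanged) and reversing the orientation; $K$ is \emph{invertible} if it is isotopic to $-K$ as a long singular knot. \textbf{Polynomials.} Let $D$ be a diagram of $K$, with writhe $w(D)$, the sum of the signs of the classical crossings. (i) The singular Kauffman bracket $\langle D\rangle_s$ is the sum over all ways of smoothing all vertices of the product of the coefficients of the smoothings times $(-A^2-A^{-2})^{c-1}$, where $c$ is the number of components of the smoothed diagram, the long one included. At a positive crossing the oriented smoothing has coefficient $A$ and the other one $A^{-1}$; at a negative crossing $A^{-1}$ and $A$; at $p_i$ the oriented smoothing has coefficient $B_i$ and the other one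 $B_i^{-1}$. Put $V^s_K=(-A)^{-3w(D)}\langle D\rangle_s\in\mathbb Z[A^{\pm1},B_1^{\pm1},B_2^{\pm1},\dots]$. (ii) A Kauffman state puts one dot at each vertex, in one of its four corners, so that each bounded region of the complement of the diagram contains exactly one dot and the two unbounded regions contain none. A dot in the corner to the left of both strands, or to the right of both strands, contributes $1$. A dot between the two outgoing arcs contributes $A$, $A^{-1}$, $B_i$ at a positive crossing, at a negative crossing and at $p_i$ respectively; a dot between the two incoming arcs contributes $-A^{-1}$, $-A$, $B_i-A-A^{-1}$ respectively. $\Delta^s_K\in\mathbb Z[A^{\pm1},B_1,B_2,\dots]$ is the sum over all states of the products of the contributions. (iii) Replacing every $B_i$ by one variable $B$ gives the one-variable-$B$ polynomials $V^s_K(A,B)$ and $\Delta^s_K(A,B)$. (iv) The three-variable HOMFLY-PT polynomial of an oriented singular link diagram is $P=a^{-w}R$, where $R$ is $1$ on the trivial diagram of the unknot, invariant under the moves above except the first Reidemeister move, multiplied by $a^{\pm1}$ when a kink with a crossing of sign $\pm1$ is added, and satisfies $R(X_+)-R(X_-)=(\alpha-\beta)R(X_0)$ and $R(X)=R(X_+)-\alpha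 R(X_0)=R(X_-)-\beta R(X_0)$, where $X$ is a double point, $X_\pm$ the two crossings and $X_0$ the oriented smoothing. It is evaluated by resolving all vertices into descending diagrams with these relations. It is applied to long singular knots through their closures in $S^3$. \textbf{The example.} Let $T$ be the following long singular trefoil with two double points: take the standard closed $2$-braid diagram of the trefoil whose three vertices are one double point and two positive crossings, cut it open at the arc that leads into the double point, and insert a kink whose vertex is a second double point into the outgoing end. (Thus the order of passages is $p_1,c_1,c_2,p_1,c_1,c_2,p_2,p_2$.) Then: 1. $\langle T\rangle_s=A^{-6}B_1^{-1}B_2^{-1}+(-A^4-A^{-4})B_1B_2^{-1}+(-A^{-4}-A^{-8})B_1^{-1}B_2+(A^6+A^2+A^{-2}+A^{-6})B_1B_2$ and $V^s_T=A^{-6}\langle T\rangle_s$. 2. $V^s_{-T}(A,B_1,B_2)=V^s_T(A,B_2,B_1)$, and this differs from $V^s_T(A,B_1,B_2)$. 3. $\Delta^s_T=A^{-2}+(A-A^{-1})B_1$ and $\Delta^s_{-T}=A^{-2}+(A-A^{-1})B_2$; in particular they are different. 4. $T$ is not invertible as a long singular knot. 5. $V^s_T(A,B)=V^s_{-T}(A,B)$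 and $\Delta^s_T(A,B)=\Delta^s_{-T}(A,B)$, and the HOMFLY-PT polynomials for singular links of $T$ and $-T$ coincide; so these invariants do not detect the non-invertibility of $T$. -/

import Mathlib

/-! Planar diagrams of oriented long singular knots, encoded by their Gauss codes.

A long knot diagram is traversed from left to right, and each passage through a vertex (a classical
crossing or a double point) is recorded. A connected diagram in the plane, up to planar isotopy, is
the same thing as such a code for which the induced cell structure of the sphere has genus `0`. -/

namespace SingularKnot

/-- Positive crossing, negative crossing, double point. -/
inductive Kind where
  | pos | neg | double
  deriving DecidableEq, Repr

/-- One passage through a vertex. At every vertex, the two oriented strands are called *leading* and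
*trailing* in such a way that (leading direction, trailing direction) is a positively oriented basis
of the plane; thus the trailing strand crosses the leading one from its right to its left. -/
structure Pass where
  label : ℕ
  lead : Bool
  kind : Kind
  deriving DecidableEq, Repr

/-- The passage of the other strand through the same vertex. -/
def Pass.flip (p : Pass) : Pass := ⟨p.label, !p.lead, p.kind⟩

/-- The passage is on the upper strand of a classical crossing: at a positive crossing the leading
strand is the upper one, at a negative crossing the trailing strand is. -/
def Pass.IsOver (p : Pass) : Prop :=
  (p.kind = .pos ∧ p.lead = true) ∨ (p.kind = .neg ∧ p.lead = false)

/-- The passage is on the lower strand of a classical crossing. -/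
def Pass.IsUnder (p : Pass) : Prop :=
  (p.kind = .pos ∧ p.lead = false) ∨ (p.kind = .neg ∧ p.lead = true)

/-- The passages met along a long knot. -/
abbrev Word := List Pass

/-- Each passage occurs once, together with the other passage through its vertex, and distinct
vertices have distinct labels. -/
def IsGaussCode (w : Word) : Prop :=
  w.Nodup ∧ (∀ p ∈ w, p.flip ∈ w) ∧ ∀ p ∈ w, ∀ q ∈ w, p.label = q.label → q = p ∨ q = p.flip

/-- The labels of the double points, in the order of the first passage. -/
def doubleLabels (w : Word) : List ℕ :=
  ((w.filter fun p => p.kind = .double).map Pass.label).eraseDups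

/-- A vertex of the diagram. The arcs of a code with `2n` passages are numbered `0, …, 2n`, arc `k`
being the one that enters the `k`-th passage (counted from `0`) and arc `k + 1` the one that leaves
it. The leading strand runs from arc `x` to arc `x + 1`, the trailing one from `y` to `y + 1`.
For the `i`-th double point (`i = 1, 2, …`), `index = i`. -/
structure Vertex where
  x : ℕ
  y : ℕ
  kind : Kind
  index : ℕ
  deriving DecidableEq, Repr

/-- The vertices of the diagram, one for each leading passage. -/
def vertices (w : Word) : List Vertex :=
  (w.filter fun p => p.lead).map fun p =>
    ⟨w.idxOf p, w.idxOf p.flip, p.kind, (doubleLabels w).idxOf p.label + 1⟩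

/-- The equivalence relation on `{0, …, N - 1}` generated by a list of pairs, as the list whose
`k`-th entry is a name of the class of `k`: the pairs are processed one after the other, merging
two classes each time. -/
def classes (N : ℕ) (pairs : List (ℕ × ℕ)) : List ℕ :=
  pairs.foldl (fun l e => l.map fun a => if a = l.getD e.2 0 then l.getD e.1 0 else a)
    (List.range N)

/-- The left side of arc `k`. -/
def left (k : ℕ) : ℕ := 2 * k

/-- The right side of arc `k`. -/
def right (k : ℕ) : ℕ := 2 * k + 1

/-- The four corners at a vertex: between the two outgoing arcs, between the two incoming arcs, to
the left of both strands, and to the right of both strands. -/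
inductive Corner where
  | front | back | leftmost | rightmost
  deriving DecidableEq, Repr

/-- The two sides of arcs that bound a corner. -/
def Vertex.corner (v : Vertex) : Corner → ℕ × ℕ
  | .front => (left (v.x + 1), right (v.y + 1))
  | .back => (right v.x, left v.y)
  | .leftmost => (left v.x, left (v.y + 1))
  | .rightmost => (right (v.x + 1), right v.y)

/-- The region of the complement of the diagram to which each side of an arc belongs: sides
that meet in a corner lie in the same region, and the two unbounded arcs bound the same two
regions, on their left and on their right. -/
def regions (w : Word) : List ℕ :=
  classes (2 * (w.length + 1))
    ([(left 0, left w.length), (right 0, right w.length)] ++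
      (vertices w).flatMap fun v =>
        [v.corner .front, v.corner .back, v.corner .leftmost, v.corner .rightmost])

/-- The code is realised by a diagram in the plane: the `n` vertices cut the sphere into `n + 2`
regions. -/
def IsPlanar (w : Word) : Prop :=
  (regions w).dedup.length = (vertices w).length + 2

/-- `w` is the code of a (planar) long singular knot diagram. -/
def IsDiagram (w : Word) : Prop := IsGaussCode w ∧ IsPlanar w

/-- The elementary moves, in one of their two directions each. Requiring the codes on both sides to
be planar (as is done below) makes the bigons and triangles in these moves regions of the plane. -/
inductive Step : Word → Word → Prop
  /-- Change of the names of the vertices. -/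
  | relabel (σ : Equiv.Perm ℕ) (w : Word) :
      Step w (w.map fun p => ⟨σ p.label, p.lead, p.kind⟩)
  /-- The first Reidemeister move: a kink is inserted. -/
  | r1 (u v : Word) (p : Pass) (hp : p.kind ≠ .double) :
      Step (u ++ v) (u ++ [p, p.flip] ++ v)
  /-- The second Reidemeister move, the two strands having parallel orientations. -/
  | r2_parallel (u v w : Word) (p q : Pass) (hl : p.label ≠ q.label)
      (h : (p.IsOver ∧ q.IsOver) ∨ (p.IsUnder ∧ q.IsUnder)) (hs : p.kind ≠ q.kind) :
      Step (u ++ v ++ w) (u ++ [p, q] ++ v ++ [p.flip, q.flip] ++ w)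
  /-- The second Reidemeister move, the two strands having opposite orientations. -/
  | r2_opposite (u v w : Word) (p q : Pass) (hl : p.label ≠ q.label)
      (h : (p.IsOver ∧ q.IsOver) ∨ (p.IsUnder ∧ q.IsUnder)) (hs : p.kind ≠ q.kind) :
      Step (u ++ v ++ w) (u ++ [p, q] ++ v ++ [q.flip, p.flip] ++ w)
  /-- The third Reidemeister move and the move `SIII`: the strand of `p, q` is moved over (or under)
  the vertex of `r`, which is a classical crossing or a double point. This strand meets the strand of
  `r` in `p` and the strand of `r.flip` in `q`; `S` and `S'` are the segments of these two strands.
  Three straight lines that meet in this order and with these orientations bound a triangle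
  exactly when the order within `S` and `S'` is the given one. The three segments may follow each
  other along the knot in any order, and each of them is reversed by the move. -/
  | triangle (u₀ u₁ u₂ u₃ : Word) (p q r : Pass) (S S' t₁ t₂ t₃ : Word)
      (hl : p.label ≠ q.label ∧ p.label ≠ r.label ∧ q.label ≠ r.label)
      (h : (p.IsOver ∧ q.IsOver) ∨ (p.IsUnder ∧ q.IsUnder))
      (hS : S = if q.lead = r.lead then [p.flip, r] else [r, p.flip])
      (hS' : S' = if p.lead = r.lead then [q.flip, r.flip] else [r.flip, q.flip])
      (ht : [t₁, t₂, t₃].Perm [[p, q], S, S']) :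
      Step (u₀ ++ t₁ ++ u₁ ++ t₂ ++ u₂ ++ t₃ ++ u₃)
        (u₀ ++ t₁.reverse ++ u₁ ++ t₂.reverse ++ u₂ ++ t₃.reverse ++ u₃)
  /-- The move `SII` for strands with parallel orientations: half a turn of the double point `p`
  carries the crossing `c` to its other side. This turns over a neighbourhood of the double
  point, so the leading and the trailing strand are exchanged at `p` and at `c`. -/
  | s2_parallel (u v w : Word) (p c : Pass) (hp : p.kind = .double) (hc : c.kind ≠ .double)
      (h : c.lead = !p.lead) :
      Step (u ++ [p, c] ++ v ++ [p.flip, c.flip] ++ w) (u ++ [c.flip, p.flip] ++ v ++ [c, p] ++ w)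
  /-- The move `SII` for strands with opposite orientations. -/
  | s2_opposite (u v w : Word) (p c : Pass) (hp : p.kind = .double) (hc : c.kind ≠ .double)
      (h : c.lead = !p.lead) :
      Step (u ++ [p, c] ++ v ++ [c.flip, p.flip] ++ w) (u ++ [c.flip, p.flip] ++ v ++ [p, c] ++ w)

/-- Isotopy of long singular knots: a finite sequence of moves between planar diagrams. -/
def Isotopic : Word → Word → Prop :=
  Relation.EqvGen fun w w' => IsDiagram w ∧ IsDiagram w' ∧ Step w w'

/-- The inverse long knot: the knot is turned about a vertical line in the plane of the diagram by
half a turn (so the diagram is reflected and upper and lower strands are exchanged), and then its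
orientation is reversed. Signs of crossings do not change. -/
def inverse (w : Word) : Word := w.reverse.map Pass.flip

/-- The long knot is isotopic to its inverse. -/
def IsInvertible (w : Word) : Prop := Isotopic w (inverse w)

/-! ### The singular Kauffman bracket and `Vˢ` -/

section Jones

variable {R : Type*} [CommRing R] (A : Rˣ) (B : ℕ → Rˣ)

/-- The two smoothings of a vertex, each given by its coefficient and the pairs of arcs it joins. The
first one respects the orientations. -/
def smoothings (v : Vertex) : List (R × List (ℕ × ℕ)) :=
  let oriented := [(v.x, v.y + 1), (v.y, v.x + 1)]
  let disoriented := [(v.x, v.y), (v.x + 1, v.y + 1)]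
  match v.kind with
  | .pos => [((A : R), oriented), (((A⁻¹ : Rˣ) : R), disoriented)]
  | .neg => [(((A⁻¹ : Rˣ) : R), oriented), ((A : R), disoriented)]
  | .double => [((B v.index : R), oriented), ((((B v.index)⁻¹ : Rˣ) : R), disoriented)]

/-- The number of components of the smoothed diagram (one of them is the long one). -/
def components (w : Word) (pairs : List (ℕ × ℕ)) : ℕ :=
  (classes (w.length + 1) pairs).dedup.length

/-- The singular Kauffman bracket: the sum over all ways to smooth all vertices, normalised to be
`1` on the trivial diagram. -/
def bracket (w : Word) : R :=
  (((vertices w).map (smoothings A B)).sections.map fun s =>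
    (s.map Prod.fst).prod *
      (-((A : R) ^ 2) - ((A⁻¹ : Rˣ) : R) ^ 2) ^ (components w (s.flatMap Prod.snd) - 1)).sum

/-- The sign of a crossing; double points do not count. -/
def Kind.sign : Kind → ℤ
  | .pos => 1
  | .neg => -1
  | .double => 0

/-- The writhe of a diagram. -/
def writhe (w : Word) : ℤ := ((vertices w).map fun v => v.kind.sign).sum

/-- `Vˢ = (-A) ^ (-3 w) ⟨D⟩ₛ`, where the `i`-th double point carries the variable `B i`. -/
def jones (w : Word) : R := (((-A) ^ (-3 * writhe w) : Rˣ) : R) * bracket A B w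

end Jones

/-! ### The Alexander polynomial `Δˢ` by Kauffman states -/

section Alexander

variable {R : Type*} [CommRing R] (A : Rˣ) (B : ℕ → R)

/-- The contribution of a dot in a corner of a vertex. -/
def dotWeight (v : Vertex) (c : Corner) : R :=
  match v.kind, c with
  | _, .leftmost => 1
  | _, .rightmost => 1
  | .pos, .front => (A : R)
  | .pos, .back => -((A⁻¹ : Rˣ) : R)
  | .neg, .front => ((A⁻¹ : Rˣ) : R)
  | .neg, .back => -(A : R)
  | .double, .front => B v.index
  | .double, .back => B v.index - (A : R) - ((A⁻¹ : Rˣ) : R)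

/-- The possible dots at a vertex, each given by its contribution and the region it lies in. -/
def dots (w : Word) (v : Vertex) : List (R × ℕ) :=
  [Corner.front, .back, .leftmost, .rightmost].map fun c =>
    (dotWeight A B v c, (regions w).getD (v.corner c).1 0)

/-- The dots, one at each vertex, form a Kauffman state: they lie in pairwise different regions, and
not in one of the two unbounded regions (the star regions). For a planar diagram with `n` vertices
there are exactly `n` other regions, so each of them contains exactly one dot. -/
def IsState (w : Word) (l : List ℕ) : Prop :=
  l.Nodup ∧ (regions w).getD (left 0) 0 ∉ l ∧ (regions w).getD (right 0) 0 ∉ l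

instance (w : Word) : DecidablePred (IsState w) := fun l => by
  unfold IsState; infer_instance

/-- `Δˢ`: the sum over all Kauffman states of the product of the contributions of the dots. -/
def alexander (w : Word) : R :=
  ((((vertices w).map (dots A B w)).sections.filter fun s => IsState w (s.map Prod.snd)).map
    fun s => (s.map Prod.fst).prod).sum

end Alexander

/-! ### The HOMFLY-PT polynomial of singular links -/

section Homfly

variable {F : Type*} [Field F] (a A B : F)

/-- Orientation-preserving smoothing of a link diagram at the vertex of `p`, where `p :: cur` is the
part of one component that follows a base point, and `rest` is the list of other components (each a
cyclic code, written from some base point). -/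
def smoothAt (p : Pass) (cur : Word) (rest : List Word) : Word × List Word :=
  if p.flip ∈ cur then
    (cur.drop (cur.idxOf p.flip + 1), cur.take (cur.idxOf p.flip) :: rest)
  else
    let c := (rest.find? fun c => p.flip ∈ c).getD []
    (c.drop (c.idxOf p.flip + 1) ++ c.take (c.idxOf p.flip) ++ cur, rest.erase c)

/-- Evaluation of the polynomial by the skein relations
`[X₊] - [X₋] = (A - B) [X₀]` and `[X] = [X₊] - A [X₀] = [X₋] - B [X₀]` (`X` a double point),
by walking along the components of the diagram from base points. If a vertex is reached for the first
time on the upper strand, it is left as it is. Otherwise it is written, by one of the relations, as a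
combination of the crossing with the current strand on top and of the oriented smoothing. In the end
each diagram is descending, that is, a diagram of a trivial link, and contributes `a ^ writhe` times
`(a - a⁻¹) / (A - B)` for each component after the first. `seen` lists the vertices that have been
passed; the number of passages and components yet to be visited bounds the recursion. -/
def homflyWalk : ℕ → List ℕ → Word → List Word → F
  | 0, _, _, _ => 1
  | _ + 1, _, [], [] => 1
  | n + 1, seen, [], c :: rest => (a - a⁻¹) / (A - B) * homflyWalk n seen c rest
  | n + 1, seen, p :: cur, rest =>
    if p.label ∈ seen then homflyWalk n seen cur rest
    else
      let top := homflyWalk n (p.label :: seen) cur rest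
      let smooth := homflyWalk n seen (smoothAt p cur rest).1 (smoothAt p cur rest).2
      match p.kind, p.lead with
      | .pos, true => a * top
      | .neg, false => a⁻¹ * top
      | .pos, false => a⁻¹ * top + (A - B) * smooth
      | .neg, true => a * top - (A - B) * smooth
      | .double, true => a * top - A * smooth
      | .double, false => a⁻¹ * top - B * smooth

/-- The three-variable HOMFLY-PT polynomial of the singular knot in the 3-sphere that is the closure
of a long singular knot, normalised to be `1` on the unknot. -/
def homfly (w : Word) : F := a ^ (-writhe w) * homflyWalk a A B (w.length + 1) [] w []

end Homfly

/-! ### Rings of polynomials, and the long singular trefoil -/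

noncomputable section

/-- The ring `ℤ[A, A⁻¹, B₁, B₁⁻¹, B₂, B₂⁻¹, …]` of Laurent polynomials. -/
abbrev Laurent := AddMonoidAlgebra ℤ (ℕ →₀ ℤ)

/-- The variables of the Laurent polynomial ring, as units. -/
def laurentVar (i : ℕ) : Laurentˣ where
  val := AddMonoidAlgebra.single (Finsupp.single i 1) 1
  inv := AddMonoidAlgebra.single (Finsupp.single i (-1)) 1
  val_inv := by
    rw [AddMonoidAlgebra.single_mul_single, ← Finsupp.single_add]
    simp [AddMonoidAlgebra.one_def]
  inv_val := by
    rw [AddMonoidAlgebra.single_mul_single, ← Finsupp.single_add]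
    simp [AddMonoidAlgebra.one_def]

/-- The variable `A`. -/
def varA : Laurentˣ := laurentVar 0

/-- The variable `B i`, for `i = 1, 2, …`. -/
def varB (i : ℕ) : Laurentˣ := laurentVar i

/-- The field of rational functions in three variables. -/
abbrev Rat3 := FractionRing (MvPolynomial (Fin 3) ℤ)

/-- The variables of the field of rational functions. -/
def ratVar (i : Fin 3) : Rat3 := algebraMap (MvPolynomial (Fin 3) ℤ) Rat3 (MvPolynomial.X i)

end

/-- The long singular trefoil with two double points: the closed 2-braid that consists of a double
point (vertex `1`) and two positive crossings (vertices `3` and `4`), cut open in front of the double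
point, followed by a kink whose vertex is a double point (vertex `2`). -/
def trefoil : Word :=
  [⟨1, true, .double⟩, ⟨3, false, .pos⟩, ⟨4, true, .pos⟩,
   ⟨1, false, .double⟩, ⟨3, true, .pos⟩, ⟨4, false, .pos⟩,
   ⟨2, true, .double⟩, ⟨2, false, .double⟩]

end SingularKnot

namespace SingularKnot

/-! The polynomial identities are finite state sums or skein trees of two explicit codes. Inversion
interchanges the numbers of the two double points: the one in the trefoil part comes first in `T`
and last in `-T`. Polynomials with separate variables `B₁`, `B₂` see this, and those with a single
`B` do not.

Non-invertibility is proved without the polynomials. Smoothing a double point `d` along the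
orientation cuts the long knot into a closed lobe and a long one, and the crossings between the
lobes are exactly those whose chords are linked with the chord of `d` in the Gauss code. The sum of
their signs is an isotopy invariant of the double point; `lobeLinking` counts each crossing at both
of its passages, hence doubles this sum. A long knot has a first and a last point, so the order in
which double points are met is invariant as well. Hence the list `lobeLinkings`, which records
values without labels, is an isotopy invariant (`lobeLinkings_eq_of_isotopic`). It is `[4, 4, 0, 0]`
for `T` and `[0, 0, 4, 4]` for `-T`.

Invariance is checked move by move on Gauss codes. The substantial case is a strand passing a double
point (`linked_triangle`, `lobeLinkings_triangle`). -/

theorem isDiagram_trefoil : IsDiagram trefoil := by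
  unfold IsDiagram IsGaussCode IsPlanar
  decide

theorem isDiagram_inverse_trefoil : IsDiagram (inverse trefoil) := by
  unfold IsDiagram IsGaussCode IsPlanar
  decide

/-- The index `3` of the crossings is a default: `idxOf` returns the length `2` for a label that is
not among the double points. It enters no weight. -/
theorem vertices_trefoil : vertices trefoil =
    [⟨0, 3, .double, 1⟩, ⟨2, 5, .pos, 3⟩, ⟨4, 1, .pos, 3⟩, ⟨6, 7, .double, 2⟩] := by
  decide

theorem vertices_inverse_trefoil : vertices (inverse trefoil) =
    [⟨0, 1, .double, 1⟩, ⟨2, 5, .pos, 3⟩, ⟨4, 7, .double, 2⟩, ⟨6, 3, .pos, 3⟩] := by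
  decide

/-! ### The bracket and `Vˢ` -/

section
variable {R : Type*} [CommRing R] (A : Rˣ) (B : ℕ → Rˣ)

theorem writhe_trefoil : writhe trefoil = 2 := by
  simp [writhe, vertices_trefoil, Kind.sign]

theorem writhe_inverse_trefoil : writhe (inverse trefoil) = 2 := by
  simp [writhe, vertices_inverse_trefoil, Kind.sign]

/-- The sum factors as `(A⁻⁶ B₁⁻¹ + (-A⁴ - A⁻⁴) B₁) (B₂⁻¹ + (-A² - A⁻²) B₂)`: the second factor
comes from the kink, whose oriented smoothing splits off a circle. -/
theorem bracket_trefoil :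
    bracket A B trefoil =
      (↑A⁻¹ : R) ^ 6 * ↑(B 1)⁻¹ * ↑(B 2)⁻¹ +
        (-(A : R) ^ 4 - (↑A⁻¹ : R) ^ 4) * (B 1 : R) * ↑(B 2)⁻¹ +
        (-(↑A⁻¹ : R) ^ 4 - (↑A⁻¹ : R) ^ 8) * ↑(B 1)⁻¹ * (B 2 : R) +
        ((A : R) ^ 6 + (A : R) ^ 2 + (↑A⁻¹ : R) ^ 2 + (↑A⁻¹ : R) ^ 6) * (B 1 : R) * (B 2 : R) := by
  have h : (A : R) * ↑A⁻¹ = 1 := A.mul_inv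
  have hl : trefoil.length = 8 := rfl
  simp [bracket, vertices_trefoil, smoothings, List.sections, components, classes, hl,
    List.range_succ]
  -- The 16 smoothings are now expanded; `a * a' = 1` is the only relation that is still needed.
  generalize (A : R) = a at *
  generalize (↑A⁻¹ : R) = a' at *
  grind

end
section
variable {R : Type*} [CommRing R] (A : Rˣ) (B : ℕ → Rˣ)

theorem bracket_inverse_trefoil :
    bracket A B (inverse trefoil) = bracket A (B ∘ Equiv.swap 1 2) trefoil := by
  have h : (A : R) * ↑A⁻¹ = 1 := A.mul_inv
  have hl : (inverse trefoil).length = 8 := rfl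
  rw [bracket_trefoil]
  simp [bracket, vertices_inverse_trefoil, smoothings, List.sections, components, classes, hl,
    List.range_succ]
  generalize (A : R) = a at *
  generalize (↑A⁻¹ : R) = a' at *
  grind

theorem jones_inverse_trefoil :
    jones A B (inverse trefoil) = jones A (B ∘ Equiv.swap 1 2) trefoil := by
  simp only [jones, writhe_trefoil, writhe_inverse_trefoil, bracket_inverse_trefoil]

theorem jones_trefoil : jones A B trefoil = (↑A⁻¹ : R) ^ 6 * bracket A B trefoil := by
  have h : (-A) ^ (-3 * (2 : ℤ)) = A⁻¹ ^ 6 := by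
    rw [show (-3 * (2 : ℤ)) = -((6 : ℕ) : ℤ) by norm_num, zpow_neg, zpow_natCast, inv_pow,
      Even.neg_pow (by decide)]
  rw [jones, writhe_trefoil, h, Units.val_pow_eq_pow_val]

/-- Positions `2k` and `2k + 1` are the left and right sides of arc `k`. The six names are those
that survive the successive merging; the first two entries name the star regions. -/
theorem regions_trefoil :
    regions trefoil = [0, 14, 2, 3, 0, 5, 14, 3, 0, 2, 5, 3, 0, 14, 14, 15, 0, 14] := by
  decide

theorem regions_inverse_trefoil :
    regions (inverse trefoil) = [8, 1, 1, 3, 8, 1, 6, 7, 8, 9, 1, 7, 8, 6, 9, 7, 8, 1] := by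
  decide

end

/-! ### The Alexander polynomial -/

section
variable {R : Type*} [CommRing R] (A : Rˣ) (B : ℕ → R)

-- `B 2` is absent because three corners of the kink vertex lie in star regions; its dot is forced
-- into the loop of the kink, in a side corner of weight `1`. In `-T` the same happens to the double
-- point numbered `1`.
set_option maxRecDepth 100000 in
set_option maxHeartbeats 1000000 in
theorem alexander_trefoil :
    alexander A B trefoil = (↑A⁻¹ : R) ^ 2 + ((A : R) - ↑A⁻¹) * B 1 := by
  have h : (A : R) * ↑A⁻¹ = 1 := A.mul_inv
  simp [alexander, vertices_trefoil, dots, dotWeight, Vertex.corner, left, right, regions_trefoil,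
    List.sections, IsState]
  generalize (A : R) = a at *
  generalize (↑A⁻¹ : R) = a' at *
  grind

set_option maxRecDepth 100000 in
set_option maxHeartbeats 1000000 in
theorem alexander_inverse_trefoil :
    alexander A B (inverse trefoil) = (↑A⁻¹ : R) ^ 2 + ((A : R) - ↑A⁻¹) * B 2 := by
  have h : (A : R) * ↑A⁻¹ = 1 := A.mul_inv
  simp [alexander, vertices_inverse_trefoil, dots, dotWeight, Vertex.corner, left, right,
    regions_inverse_trefoil, List.sections, IsState]
  generalize (A : R) = a at *
  generalize (↑A⁻¹ : R) = a' at *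
  grind
end

/-! ### The HOMFLY-PT polynomial -/

section
variable {F : Type*} [Field F] (a A B : F)
-- By the skein relation a kink at a double point multiplies the polynomial by a scalar, wherever
-- the kink sits, and the closed singular trefoil that remains is the same for both knots. The proof
-- evaluates the two skein trees; the denominators are powers of `a` and of `A - B`.
theorem homfly_inverse_trefoil (ha : a ≠ 0) (hAB : A ≠ B) :
    homfly a A B (inverse trefoil) = homfly a A B trefoil := by
  have h : A - B ≠ 0 := sub_ne_zero.mpr hAB
  rw [homfly, homfly, writhe_trefoil, writhe_inverse_trefoil]
  congr 1
  simp [inverse, trefoil, homflyWalk, smoothAt, Pass.flip]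
  field_simp
  ring
end
-- Linked chords of a Gauss code
/-- The entries of `l` that are equal to `d` or `c`. -/
def restrict (d c : ℕ) (l : List ℕ) : List ℕ := l.filter fun x => x = d ∨ x = c

@[simp] theorem restrict_nil (d c : ℕ) : restrict d c [] = [] := rfl

theorem restrict_cons (d c x : ℕ) (l : List ℕ) :
    restrict d c (x :: l) = if x = d ∨ x = c then x :: restrict d c l else restrict d c l := by
  simp only [restrict, List.filter_cons, decide_eq_true_eq]

@[simp] theorem restrict_append (d c : ℕ) (l l' : List ℕ) :
    restrict d c (l ++ l') = restrict d c l ++ restrict d c l' := List.filter_append ..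

theorem restrict_eq_nil {d c : ℕ} {l : List ℕ} (hd : d ∉ l) (hc : c ∉ l) :
    restrict d c l = [] := by
  rw [restrict, List.filter_eq_nil_iff]
  intro x hx
  rw [decide_eq_true_eq]
  rintro (rfl | rfl)
  exacts [hd hx, hc hx]

/-- Exchanging two neighbouring letters can affect the linking only of the two chords that they
belong to. This localises `SII` and the triangle move. -/
theorem restrict_pair_comm {d c a b : ℕ} (h : ¬ ((a = d ∨ a = c) ∧ (b = d ∨ b = c))) :
    restrict d c [a, b] = restrict d c [b, a] := by
  simp only [restrict_cons, restrict_nil]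
  split_ifs <;> tauto

theorem restrict_map {σ : ℕ → ℕ} (hσ : σ.Injective) (d c : ℕ) (l : List ℕ) :
    restrict (σ d) (σ c) (l.map σ) = (restrict d c l).map σ := by
  simp [restrict, List.filter_map, Function.comp_def, hσ.eq_iff]

/-- The chords of the labels `d` and `c` are linked in a Gauss code with the labels `l`. -/
def Linked (l : List ℕ) (d c : ℕ) : Prop :=
  d ≠ c ∧ (restrict d c l = [d, c, d, c] ∨ restrict d c l = [c, d, c, d])

instance (l : List ℕ) (d c : ℕ) : Decidable (Linked l d c) := by
  unfold Linked; infer_instance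

theorem Linked.congr {l l' : List ℕ} {d c : ℕ} (h : restrict d c l = restrict d c l') :
    Linked l d c ↔ Linked l' d c := by
  rw [Linked, Linked, h]

theorem linked_map {σ : ℕ → ℕ} (hσ : σ.Injective) (l : List ℕ) (d c : ℕ) :
    Linked (l.map σ) (σ d) (σ c) ↔ Linked l d c := by
  have h (a b : ℕ) : restrict (σ d) (σ c) (l.map σ) = [σ a, σ b, σ a, σ b] ↔
      restrict d c l = [a, b, a, b] := by
    rw [restrict_map hσ]
    exact (List.map_injective_iff.mpr hσ).eq_iff (b := [a, b, a, b])
  rw [Linked, Linked, h, h, hσ.ne_iff]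

/-- Two chords are linked when exactly one end of the first lies between the ends of the second.
Since `d` occurs twice in all, only its numbers of occurrences in the three gaps matter, which
leaves finitely many cases. -/
theorem linked_iff_count {x y z : List ℕ} {d c : ℕ} (hdc : d ≠ c) (hx : c ∉ x) (hy : c ∉ y)
    (hz : c ∉ z) (hd : (x ++ [c] ++ y ++ [c] ++ z).count d = 2) :
    Linked (x ++ [c] ++ y ++ [c] ++ z) d c ↔ y.count d = 1 := by
  have h (l : List ℕ) (hl : c ∉ l) : restrict d c l = List.replicate (l.count d) d := by
    rw [← List.filter_eq, restrict]
    refine List.filter_congr fun a ha => ?_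
    have : a ≠ c := fun e => hl (e ▸ ha)
    simp [this, eq_comm]
  simp only [List.count_append, List.count_singleton, beq_iff_eq, hdc.symm, if_false] at hd
  simp only [Linked, restrict_append, h x hx, h y hy, h z hz, restrict_cons, or_true, if_true,
    restrict_nil]
  generalize x.count d = i at *
  generalize y.count d = j at *
  generalize z.count d = k at *
  have hi : i ≤ 2 := by omega
  have hj : j ≤ 2 := by omega
  obtain rfl : k = 2 - i - j := by omega
  interval_cases i <;> interval_cases j <;> simp [hdc, hdc.symm, List.replicate] at hd ⊢

/-! ### Signed sums over linked chords and the list of lobe linkings -/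

/-- The labels of the passages. -/
def labels (w : Word) : List ℕ := w.map Pass.label

@[simp] theorem labels_nil : labels [] = [] := rfl

@[simp] theorem labels_cons (p : Pass) (w : Word) : labels (p :: w) = p.label :: labels w := rfl

@[simp] theorem labels_append (w w' : Word) : labels (w ++ w') = labels w ++ labels w' :=
  List.map_append

@[simp] theorem Pass.flip_label (p : Pass) : p.flip.label = p.label := rfl

@[simp] theorem Pass.flip_kind (p : Pass) : p.flip.kind = p.kind := rfl

theorem Pass.flip_ne (p : Pass) : p ≠ p.flip := fun h => by
  have := congrArg Pass.lead h
  simp [Pass.flip] at this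

theorem mem_labels {w : Word} {p : Pass} (h : p ∈ w) : p.label ∈ labels w := List.mem_map_of_mem h

theorem IsGaussCode.kind_eq {w : Word} (hw : IsGaussCode w) {p q : Pass} (hp : p ∈ w) (hq : q ∈ w)
    (h : p.label = q.label) : p.kind = q.kind := by
  rcases hw.2.2 p hp q hq h with rfl | rfl <;> rfl

theorem IsGaussCode.count_label {w : Word} (hw : IsGaussCode w) {p : Pass} (hp : p ∈ w) :
    (labels w).count p.label = 2 := by
  have h : (w.filter fun q => q.label = p.label).Perm [p, p.flip] := by
    rw [List.perm_ext_iff_of_nodup (hw.1.filter _) (by simpa using p.flip_ne)]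
    intro q
    simp only [List.mem_filter, decide_eq_true_eq, List.mem_cons, List.not_mem_nil, or_false]
    constructor
    · exact fun h => hw.2.2 p hp q h.1 h.2.symm
    · rintro (rfl | rfl)
      exacts [⟨hp, rfl⟩, ⟨hw.2.1 _ hp, rfl⟩]
  rw [labels, List.count, List.countP_map, List.countP_eq_length_filter]
  exact (by simpa [Function.comp_def, beq_eq_decide] using h.length_eq)

/-- The sum of the signs of the passages of `v` whose chords are linked with `d` in `l`. -/
def linkedSignSum (l : List ℕ) (d : ℕ) (v : Word) : ℤ :=
  (v.map fun q => if Linked l d q.label then q.kind.sign else 0).sum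

@[simp] theorem linkedSignSum_nil (l : List ℕ) (d : ℕ) : linkedSignSum l d [] = 0 := rfl

@[simp] theorem linkedSignSum_cons (l : List ℕ) (d : ℕ) (q : Pass) (v : Word) :
    linkedSignSum l d (q :: v) =
      (if Linked l d q.label then q.kind.sign else 0) + linkedSignSum l d v := by
  simp [linkedSignSum]

@[simp] theorem linkedSignSum_append (l : List ℕ) (d : ℕ) (v v' : Word) :
    linkedSignSum l d (v ++ v') = linkedSignSum l d v + linkedSignSum l d v' := by
  simp [linkedSignSum]

theorem linkedSignSum_congr {l l' : List ℕ} {d : ℕ} {v : Word}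
    (h : ∀ c ∈ labels v, restrict d c l = restrict d c l') :
    linkedSignSum l d v = linkedSignSum l' d v := by
  rw [linkedSignSum, linkedSignSum]
  congr 1
  refine List.map_congr_left fun q hq => ?_
  simp only [Linked.congr (h _ (mem_labels hq))]

/-- The labels of the passages through double points. -/
def doublePassages (w : Word) : List ℕ := (w.filter fun p => p.kind = .double).map Pass.label

/-- Twice the linking number of the two lobes at the double point `d`. -/
def lobeLinking (w : Word) (d : ℕ) : ℤ := linkedSignSum (labels w) d w

/-- The lobe linkings at the double points, in the order of their passages. -/
def lobeLinkings (w : Word) : List ℤ := (doublePassages w).map (lobeLinking w)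

theorem lobeLinkings_congr {w w' : Word} (hD : doublePassages w = doublePassages w')
    (h : ∀ p ∈ w, p.kind = .double → lobeLinking w p.label = lobeLinking w' p.label) :
    lobeLinkings w = lobeLinkings w' := by
  rw [lobeLinkings, lobeLinkings, ← hD]
  refine List.map_congr_left fun d hd => ?_
  obtain ⟨p, hp, rfl⟩ := List.mem_map.mp hd
  rw [List.mem_filter, decide_eq_true_eq] at hp
  exact h p hp.1 hp.2

theorem lobeLinkings_trefoil : lobeLinkings trefoil = [4, 4, 0, 0] := by decide

theorem lobeLinkings_inverse_trefoil : lobeLinkings (inverse trefoil) = [0, 0, 4, 4] := by decide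

/-! ### Invariance of the lobe linkings under the moves -/

theorem lobeLinkings_relabel (σ : Equiv.Perm ℕ) (w : Word) :
    lobeLinkings (w.map fun p => ⟨σ p.label, p.lead, p.kind⟩) = lobeLinkings w := by
  have h : labels (w.map fun p => ⟨σ p.label, p.lead, p.kind⟩) = (labels w).map σ := by
    simp [labels]
  simp [lobeLinkings, doublePassages, lobeLinking, h, List.filter_map, linkedSignSum,
    Function.comp_def, linked_map σ.injective]

/-- The chord of a kink has nothing between its ends, so it is linked with no other chord, and
deleting it does not change how the others are linked. -/
theorem lobeLinkings_r1 {u v : Word} {p : Pass} (hp : p.kind ≠ .double)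
    (hw : IsGaussCode (u ++ [p, p.flip] ++ v)) :
    lobeLinkings (u ++ [p, p.flip] ++ v) = lobeLinkings (u ++ v) := by
  have hcp := hw.count_label (p := p) (by simp)
  simp only [labels_append, labels_cons, labels_nil, Pass.flip_label, List.count_append,
    List.count_cons_self, List.count_nil] at hcp
  have hu : p.label ∉ labels u := List.count_eq_zero.mp (by omega)
  have hv : p.label ∉ labels v := List.count_eq_zero.mp (by omega)
  refine lobeLinkings_congr (by simp [doublePassages, hp]) fun x hx hxd => ?_
  have hne : x.label ≠ p.label := fun e => hp (hw.kind_eq hx (by simp) e ▸ hxd)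
  have hc := hw.count_label hx
  have hlink : ¬ Linked (labels (u ++ [p, p.flip] ++ v)) x.label p.label := by
    have := linked_iff_count (y := []) hne hu (by simp) hv (by simpa using hc)
    simpa using this
  have hr (c) (hcp : c ≠ p.label) : restrict x.label c (labels (u ++ [p, p.flip] ++ v)) =
      restrict x.label c (labels (u ++ v)) := by
    simp [restrict_cons, hne.symm, hcp.symm]
  have h (t : Word) (ht : p.label ∉ labels t) := linkedSignSum_congr (v := t) fun c hc =>
    hr c fun e => ht (e ▸ hc)
  rw [lobeLinking, lobeLinking, linkedSignSum_append, linkedSignSum_append, h u hu, h v hv]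
  simp only [linkedSignSum_cons, Pass.flip_label, hlink, if_false, linkedSignSum_append,
    linkedSignSum_nil]
  ring

theorem sign_eq_neg_of_bigon {p q : Pass}
    (h : (p.IsOver ∧ q.IsOver) ∨ (p.IsUnder ∧ q.IsUnder)) (hs : p.kind ≠ q.kind) :
    p.kind ≠ .double ∧ q.kind ≠ .double ∧ q.kind.sign = -p.kind.sign := by
  obtain ⟨_, _, _⟩ := p
  obtain ⟨_, _, _⟩ := q
  simp only [Pass.IsOver, Pass.IsUnder] at h hs
  rcases h with ⟨h | h, h' | h'⟩ | ⟨h | h, h' | h'⟩ <;>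
    simp_all [Kind.sign]

/-- Two crossings of opposite signs whose passages follow each other on both strands. -/
theorem lobeLinkings_r2 {u v w : Word} {p q p' q' : Pass} (hl : p.label ≠ q.label)
    (hp : p.kind ≠ .double) (hq : q.kind ≠ .double) (hs : q.kind.sign = -p.kind.sign)
    (h' : (p' = p.flip ∧ q' = q.flip) ∨ (p' = q.flip ∧ q' = p.flip))
    (hw : IsGaussCode (u ++ [p, q] ++ v ++ [p', q'] ++ w)) :
    lobeLinkings (u ++ [p, q] ++ v ++ [p', q'] ++ w) = lobeLinkings (u ++ v ++ w) := by
  have hcp := hw.count_label (p := p) (by simp)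
  have hcq := hw.count_label (p := q) (by simp)
  have hp' : p'.kind ≠ .double := by rcases h' with ⟨rfl, rfl⟩ | ⟨rfl, rfl⟩ <;> assumption
  have hq' : q'.kind ≠ .double := by rcases h' with ⟨rfl, rfl⟩ | ⟨rfl, rfl⟩ <;> assumption
  have hlab : (p'.label = p.label ∧ q'.label = q.label) ∨
      (p'.label = q.label ∧ q'.label = p.label) := by
    rcases h' with ⟨rfl, rfl⟩ | ⟨rfl, rfl⟩ <;> simp
  have hcount (a : ℕ) : [p'.label, q'.label].count a = [p.label, q.label].count a := by
    rcases hlab with ⟨h1, h2⟩ | ⟨h1, h2⟩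
    · rw [h1, h2]
    · rw [h1, h2]
      exact (List.Perm.swap ..).count_eq a
  simp only [labels_append, List.count_append, labels_cons, labels_nil, hcount] at hcp hcq
  simp only [List.count_cons, List.count_nil, beq_self_eq_true, if_true, beq_iff_eq, hl, hl.symm,
    if_false] at hcp hcq
  have hpn : p.label ∉ labels u ∧ p.label ∉ labels v ∧ p.label ∉ labels w := by
    simp only [← List.count_eq_zero]; omega
  have hqn : q.label ∉ labels u ∧ q.label ∉ labels v ∧ q.label ∉ labels w := by
    simp only [← List.count_eq_zero]; omega
  refine lobeLinkings_congr (by simp [doublePassages, hp, hq, hp', hq'])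
    fun x hx hxd => ?_
  have hxp : x.label ≠ p.label := fun e => hp (hw.kind_eq hx (by simp) e ▸ hxd)
  have hxq : x.label ≠ q.label := fun e => hq (hw.kind_eq hx (by simp) e ▸ hxd)
  have hc := hw.count_label hx
  -- Between the two ends of either new chord lie `v` and possibly ends of the other new chord.
  -- Hence both are linked with a double point under the same condition on `v`, and their opposite
  -- signs cancel.
  have hlp : Linked (labels (u ++ [p, q] ++ v ++ [p', q'] ++ w)) x.label p.label ↔
      (labels v).count x.label = 1 := by
    rcases hlab with ⟨h1, h2⟩ | ⟨h1, h2⟩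
    · have := linked_iff_count (x := labels u) (y := q.label :: labels v)
        (z := q.label :: labels w) hxp hpn.1 (by simp [hl, hpn]) (by simp [hl, hpn])
        (by simpa [h1, h2] using hc)
      simpa [h1, h2, List.count_cons, hxq.symm] using this
    · have := linked_iff_count (x := labels u) (y := q.label :: (labels v ++ [q.label]))
        (z := labels w) hxp hpn.1 (by simp [hl, hpn]) (by simp [hpn])
        (by simpa [h1, h2] using hc)
      simpa [h1, h2, List.count_cons, hxq.symm] using this
  have hlq : Linked (labels (u ++ [p, q] ++ v ++ [p', q'] ++ w)) x.label q.label ↔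
      (labels v).count x.label = 1 := by
    rcases hlab with ⟨h1, h2⟩ | ⟨h1, h2⟩
    · have := linked_iff_count (x := labels u ++ [p.label]) (y := labels v ++ [p.label])
        (z := labels w) hxq (by simp [hl.symm, hqn]) (by simp [hl.symm, hqn]) (by simp [hqn])
        (by simpa [h1, h2] using hc)
      simpa [h1, h2, List.count_cons, hxp.symm] using this
    · have := linked_iff_count (x := labels u ++ [p.label]) (y := labels v)
        (z := p.label :: labels w) hxq (by simp [hl.symm, hqn]) (by simp [hqn])
        (by simp [hl.symm, hqn]) (by simpa [h1, h2] using hc)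
      simpa [h1, h2, List.count_cons, hxp.symm] using this
  have hr (c) (hcp : c ≠ p.label) (hcq : c ≠ q.label) :
      restrict x.label c (labels (u ++ [p, q] ++ v ++ [p', q'] ++ w)) =
      restrict x.label c (labels (u ++ v ++ w)) := by
    rcases hlab with ⟨h1, h2⟩ | ⟨h1, h2⟩ <;>
    simp [restrict_cons, hxp.symm, hxq.symm, hcp.symm, hcq.symm, h1, h2]
  have h (t : Word) (htp : p.label ∉ labels t) (htq : q.label ∉ labels t) :=
    linkedSignSum_congr (v := t) fun c hc => hr c (fun e => htp (e ▸ hc)) fun e => htq (e ▸ hc)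
  rw [lobeLinking, lobeLinking]
  generalize labels (u ++ [p, q] ++ v ++ [p', q'] ++ w) = L at *
  simp only [linkedSignSum_append, linkedSignSum_cons, linkedSignSum_nil]
  rw [h u hpn.1 hqn.1, h v hpn.2.1 hqn.2.1, h w hpn.2.2 hqn.2.2]
  rcases h' with ⟨rfl, rfl⟩ | ⟨rfl, rfl⟩ <;>
  · simp only [Pass.flip_label, Pass.flip_kind, hlp, hlq, hs]
    split_ifs <;> ring

/-- A double point and a crossing whose passages follow each other on both strands are exchanged on
both strands. -/
theorem lobeLinkings_s2 {u v w : Word} {p c : Pass} {s s' : Word}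
    (hp : p.kind = .double) (hc : c.kind ≠ .double)
    (h : (s = [p.flip, c.flip] ∧ s' = [c, p]) ∨ (s = [c.flip, p.flip] ∧ s' = [p, c]))
    (hw : IsGaussCode (u ++ [p, c] ++ v ++ s ++ w)) :
    lobeLinkings (u ++ [p, c] ++ v ++ s ++ w) =
      lobeLinkings (u ++ [c.flip, p.flip] ++ v ++ s' ++ w) := by
  have hcp := hw.count_label (p := p) (by simp)
  have hcc := hw.count_label (p := c) (by simp)
  have hl : p.label ≠ c.label := fun e => hc (hw.kind_eq (by simp) (by simp) e ▸ hp)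
  have hs : (labels s = [p.label, c.label] ∧ labels s' = [c.label, p.label]) ∨
      (labels s = [c.label, p.label] ∧ labels s' = [p.label, c.label]) := by
    rcases h with ⟨rfl, rfl⟩ | ⟨rfl, rfl⟩ <;> simp
  have hcount (a : ℕ) : (labels s).count a = [p.label, c.label].count a := by
    rcases hs with ⟨h1, h2⟩ | ⟨h1, h2⟩
    · rw [h1]
    · rw [h1]
      exact (List.Perm.swap ..).count_eq a
  simp only [labels_append, List.count_append, labels_cons, labels_nil, hcount] at hcp hcc
  simp only [List.count_cons, List.count_nil, beq_self_eq_true, if_true, beq_iff_eq, hl, hl.symm,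
    if_false] at hcp hcc
  have hpn : p.label ∉ labels u ∧ p.label ∉ labels v ∧ p.label ∉ labels w := by
    simp only [← List.count_eq_zero]; omega
  have hcn : c.label ∉ labels u ∧ c.label ∉ labels v ∧ c.label ∉ labels w := by
    simp only [← List.count_eq_zero]; omega
  refine lobeLinkings_congr ?_ fun x hx hxd => ?_
  · rcases h with ⟨rfl, rfl⟩ | ⟨rfl, rfl⟩ <;>
    simp [doublePassages, hp, hc]
  have hxc : x.label ≠ c.label := fun e => hc (hw.kind_eq hx (by simp) e ▸ hxd)
  have hlink (e : ℕ) : Linked (labels (u ++ [p, c] ++ v ++ s ++ w)) x.label e ↔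
      Linked (labels (u ++ [c.flip, p.flip] ++ v ++ s' ++ w)) x.label e := by
    -- Only the pair `p`, `c` could notice the exchange. For parallel strands its pattern `pcpc`
    -- becomes `cpcp`, linked both times; for opposite strands `pccp` becomes `cppc`, unlinked both
    -- times.
    by_cases hpc : x.label = p.label ∧ e = c.label
    · rw [hpc.1, hpc.2, Linked, Linked]
      rcases hs with ⟨h1, h2⟩ | ⟨h1, h2⟩ <;>
      simp [h1, h2, restrict_cons, restrict_eq_nil, hpn, hcn, hl, hl.symm]
    · by_cases hxe : x.label = e
      · simp [Linked, hxe]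
      have := restrict_pair_comm (d := x.label) (c := e) (a := p.label) (b := c.label) (by grind)
      refine Linked.congr ?_
      rcases hs with ⟨h1, h2⟩ | ⟨h1, h2⟩ <;>
      simp only [labels_append, restrict_append, labels_cons, labels_nil, Pass.flip_label, h1, h2,
        this]
  rw [lobeLinking, lobeLinking]
  simp only [linkedSignSum, hlink]
  rcases h with ⟨rfl, rfl⟩ | ⟨rfl, rfl⟩ <;>
  · simp only [List.map_append, List.sum_append, List.map_cons, List.map_nil, List.sum_cons,
      List.sum_nil, Pass.flip_label, Pass.flip_kind]
    ring

theorem linkedSignSum_perm (l : List ℕ) (d : ℕ) {v v' : Word} (h : v.Perm v') :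
    linkedSignSum l d v = linkedSignSum l d v' :=
  (h.map _).sum_eq

/-- For an upper strand, and likewise for a lower one, leading or trailing determines the sign. -/
theorem sign_of_both_over_or_under {p q : Pass}
    (h : (p.IsOver ∧ q.IsOver) ∨ (p.IsUnder ∧ q.IsUnder)) :
    p.kind ≠ .double ∧ q.kind ≠ .double ∧
      q.kind.sign = if p.lead = q.lead then p.kind.sign else -p.kind.sign := by
  obtain ⟨_, _, _⟩ := p
  obtain ⟨_, _, _⟩ := q
  simp only [Pass.IsOver, Pass.IsUnder] at h
  rcases h with ⟨h | h, h' | h'⟩ | ⟨h | h, h' | h'⟩ <;>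
    simp_all [Kind.sign]

/-- The move may change whether `p` and `q` are linked with `r`, but not the signed total. For
instance, `pq, pr, qr` in this order (equal signs) passes the linking from `q` to `p`, whereas `pq,
pr, rq` (opposite signs) makes both linked, with cancelling contributions. -/
theorem linked_triangle {u₀ u₁ u₂ u₃ t₁ t₂ t₃ : List ℕ} {p q r : ℕ} {b b' : Bool} (s : ℤ)
    (hpq : p ≠ q) (hpr : p ≠ r) (hqr : q ≠ r)
    (hp : p ∉ u₀ ++ u₁ ++ u₂ ++ u₃) (hq : q ∉ u₀ ++ u₁ ++ u₂ ++ u₃) (hr : r ∉ u₀ ++ u₁ ++ u₂ ++ u₃)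
    (ht : [t₁, t₂, t₃].Perm
      [[p, q], if b then [p, r] else [r, p], if b' then [q, r] else [r, q]]) :
    (if Linked (u₀ ++ t₁ ++ u₁ ++ t₂ ++ u₂ ++ t₃ ++ u₃) r p then s else 0) +
        (if Linked (u₀ ++ t₁ ++ u₁ ++ t₂ ++ u₂ ++ t₃ ++ u₃) r q then
          (if b = b' then s else -s) else 0) =
      (if Linked (u₀ ++ t₁.reverse ++ u₁ ++ t₂.reverse ++ u₂ ++ t₃.reverse ++ u₃) r p
        then s else 0) +
        (if Linked (u₀ ++ t₁.reverse ++ u₁ ++ t₂.reverse ++ u₂ ++ t₃.reverse ++ u₃) r q then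
          (if b = b' then s else -s) else 0) := by
  simp only [List.mem_append, not_or] at hp hq hr
  obtain ⟨⟨⟨hp0, hp1⟩, hp2⟩, hp3⟩ := hp
  obtain ⟨⟨⟨hq0, hq1⟩, hq2⟩, hq3⟩ := hq
  obtain ⟨⟨⟨hr0, hr1⟩, hr2⟩, hr3⟩ := hr
  have h := List.mem_permutations.mpr ht
  -- The parts outside the three segments drop out of the restricted words, so only six orders of
  -- the segments and four choices of `b`, `b'` remain.
  simp only [Linked, restrict_append, restrict_eq_nil, *, not_false_eq_true, List.nil_append,
    List.append_nil]
  clear ht hp0 hp1 hp2 hp3 hq0 hq1 hq2 hq3 hr0 hr1 hr2 hr3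
  have hp' := hpq.symm
  have hr' := hpr.symm
  have hq' := hqr.symm
  cases b <;> cases b' <;>
  · simp [List.permutations, List.permutationsAux, List.permutationsAux.rec] at h
    rcases h with ⟨rfl, rfl, rfl⟩ | ⟨rfl, rfl, rfl⟩ | ⟨rfl, rfl, rfl⟩ | ⟨rfl, rfl, rfl⟩ |
      ⟨rfl, rfl, rfl⟩ | ⟨rfl, rfl, rfl⟩ <;>
    simp [restrict_cons, *]

theorem lobeLinkings_triangle {u₀ u₁ u₂ u₃ : Word} {p q r : Pass} {S S' t₁ t₂ t₃ : Word}
    (hl : p.label ≠ q.label ∧ p.label ≠ r.label ∧ q.label ≠ r.label)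
    (h : (p.IsOver ∧ q.IsOver) ∨ (p.IsUnder ∧ q.IsUnder))
    (hS : S = if q.lead = r.lead then [p.flip, r] else [r, p.flip])
    (hS' : S' = if p.lead = r.lead then [q.flip, r.flip] else [r.flip, q.flip])
    (ht : [t₁, t₂, t₃].Perm [[p, q], S, S'])
    (hw : IsGaussCode (u₀ ++ t₁ ++ u₁ ++ t₂ ++ u₂ ++ t₃ ++ u₃)) :
    lobeLinkings (u₀ ++ t₁ ++ u₁ ++ t₂ ++ u₂ ++ t₃ ++ u₃) =
      lobeLinkings (u₀ ++ t₁.reverse ++ u₁ ++ t₂.reverse ++ u₂ ++ t₃.reverse ++ u₃) := by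
  obtain ⟨hp, hq, hs⟩ := sign_of_both_over_or_under h
  obtain ⟨hpq, hpr, hqr⟩ := hl
  have hSp : S.Perm [p.flip, r] := by
    rw [hS]; split_ifs
    exacts [.refl _, .swap ..]
  have hSp' : S'.Perm [q.flip, r.flip] := by
    rw [hS']; split_ifs
    exacts [.refl _, .swap ..]
  have hperm : (u₀ ++ t₁ ++ u₁ ++ t₂ ++ u₂ ++ t₃ ++ u₃).Perm
      (u₀ ++ u₁ ++ u₂ ++ u₃ ++ [p, q, p.flip, r, q.flip, r.flip]) := by
    have h1 : (t₁ ++ t₂ ++ t₃).Perm [p, q, p.flip, r, q.flip, r.flip] := by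
      simpa using ht.flatten.trans (by simpa using hSp.append hSp' :
        ([[p, q], S, S'] : List Word).flatten.Perm [p, q, p.flip, r, q.flip, r.flip])
    refine List.Perm.trans ?_ (h1.append_left _)
    rw [List.perm_iff_count]
    intro a
    simp only [List.count_append]
    omega
  have hmem {a : Pass} (ha : a ∈ [p, q, p.flip, r, q.flip, r.flip]) :
      a ∈ u₀ ++ t₁ ++ u₁ ++ t₂ ++ u₂ ++ t₃ ++ u₃ :=
    hperm.mem_iff.mpr (List.mem_append_right _ ha)
  have hnot {a : Pass} (ha : a ∈ [p, q, r]) : a.label ∉ labels (u₀ ++ u₁ ++ u₂ ++ u₃) := by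
    have hc := hw.count_label (p := a) (hmem (by simp at ha ⊢; tauto))
    rw [labels, (hperm.map Pass.label).count_eq, ← labels, labels_append, List.count_append] at hc
    refine List.count_eq_zero.mp ?_
    simp only [List.mem_cons, List.not_mem_nil, or_false] at ha
    rcases ha with rfl | rfl | rfl <;>
      simp [hpq, hpr, hqr, hpq.symm, hpr.symm, hqr.symm] at hc ⊢ <;> tauto
  have hrev : (u₀ ++ t₁.reverse ++ u₁ ++ t₂.reverse ++ u₂ ++ t₃.reverse ++ u₃).Perm
      (u₀ ++ t₁ ++ u₁ ++ t₂ ++ u₂ ++ t₃ ++ u₃) := by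
    rw [List.perm_iff_count]
    simp
  -- Every segment contains a classical passage, so its reversal cannot interchange two passages
  -- through double points.
  have htpair (t : Word) (h : t ∈ [t₁, t₂, t₃]) : ∃ a b, t = [a, b] ∧
      ((a.label = p.label ∧ b.label = q.label ∧ a.kind ≠ .double) ∨
       (a.label = p.label ∧ b.label = r.label ∧ a.kind ≠ .double) ∨
       (a.label = r.label ∧ b.label = p.label ∧ b.kind ≠ .double) ∨
       (a.label = q.label ∧ b.label = r.label ∧ a.kind ≠ .double) ∨
       (a.label = r.label ∧ b.label = q.label ∧ b.kind ≠ .double)) := by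
    have := ht.mem_iff.mp h
    simp only [List.mem_cons, List.not_mem_nil, or_false] at this
    rcases this with rfl | rfl | rfl
    · exact ⟨p, q, rfl, by simp [hp]⟩
    · rw [hS]; split_ifs
      exacts [⟨_, _, rfl, by simp [hp]⟩, ⟨_, _, rfl, by simp [hp]⟩]
    · rw [hS']; split_ifs
      exacts [⟨_, _, rfl, by simp [hq]⟩, ⟨_, _, rfl, by simp [hq]⟩]
  refine lobeLinkings_congr ?_ fun x hx hxd => ?_
  · have (t : Word) (h : t ∈ [t₁, t₂, t₃]) : t.reverse.filter (fun p => p.kind = .double) =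
        t.filter (fun p => p.kind = .double) := by
      obtain ⟨a, b, rfl, h⟩ := htpair t h
      have : a.kind ≠ .double ∨ b.kind ≠ .double := by tauto
      rcases this with h | h <;> simp [List.filter_cons, h]
    simp only [doublePassages, List.filter_append, this t₁ (by simp), this t₂ (by simp),
      this t₃ (by simp)]
  have hxp : x.label ≠ p.label := fun e => hp (hw.kind_eq hx (hmem (by simp)) e ▸ hxd)
  have hxq : x.label ≠ q.label := fun e => hq (hw.kind_eq hx (hmem (by simp)) e ▸ hxd)
  -- The vertex of `x` is double while `p` and `q` are classical, so a reversed pair can involve `x`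
  -- only if `x` passes through the vertex of `r`.
  have hrestrict (e : ℕ) (he : ¬ (x.label = r.label ∧ (e = p.label ∨ e = q.label))) :
      restrict x.label e (labels (u₀ ++ t₁ ++ u₁ ++ t₂ ++ u₂ ++ t₃ ++ u₃)) = restrict x.label e
        (labels (u₀ ++ t₁.reverse ++ u₁ ++ t₂.reverse ++ u₂ ++ t₃.reverse ++ u₃)) := by
    have (t : Word) (h : t ∈ [t₁, t₂, t₃]) : restrict x.label e (labels t.reverse) =
        restrict x.label e (labels t) := by
      obtain ⟨a, b, rfl, h⟩ := htpair t h
      exact restrict_pair_comm (by grind)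
    simp only [labels_append, restrict_append, this t₁ (by simp), this t₂ (by simp),
      this t₃ (by simp)]
  rw [lobeLinking, lobeLinking, linkedSignSum_perm _ _ hrev]
  by_cases hxr : x.label = r.label
  · have htri := linked_triangle (u₀ := labels u₀) (u₁ := labels u₁) (u₂ := labels u₂)
      (u₃ := labels u₃) (t₁ := labels t₁) (t₂ := labels t₂) (t₃ := labels t₃)
      (b := q.lead = r.lead) (b' := p.lead = r.lead) p.kind.sign hpq hpr hqr
      (by simpa using hnot (a := p) (by simp)) (by simpa using hnot (a := q) (by simp))
      (by simpa using hnot (a := r) (by simp)) (by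
        have := ht.map labels
        rw [hS, hS'] at this
        simpa [apply_ite] using this)
    have hlead : (decide (q.lead = r.lead) = decide (p.lead = r.lead)) ↔ p.lead = q.lead := by
      cases p.lead <;> cases q.lead <;> cases r.lead <;> decide
    have hrev' (t : Word) : labels t.reverse = (labels t).reverse := List.map_reverse
    rw [linkedSignSum_perm _ _ hperm, linkedSignSum_perm _ _ hperm, linkedSignSum_append _ _ _ [p, _, _, _, _, _],
      linkedSignSum_append _ _ _ [p, _, _, _, _, _], linkedSignSum_congr (v := u₀ ++ u₁ ++ u₂ ++ u₃) fun c hc =>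
        hrestrict c fun e => ?_]
    · simp only [linkedSignSum_cons, linkedSignSum_nil, Pass.flip_label, Pass.flip_kind, hxr, hs]
      simp only [hlead] at htri
      simp only [labels_append, hrev']
      have (l : List ℕ) : ¬ Linked l r.label r.label := fun h => h.1 rfl
      simp only [this, if_false]
      -- The factor `2` appears because each of the crossings of `p` and `q` is counted at both of
      -- its passages.
      linear_combination 2 * htri
    · rcases e.2 with rfl | rfl
      exacts [hnot (by simp) hc, hnot (by simp) hc]
  · exact linkedSignSum_congr fun c _ => hrestrict c fun e => hxr e.1

theorem lobeLinkings_eq_of_step {w w' : Word} (h : Step w w') (hw : IsGaussCode w)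
    (hw' : IsGaussCode w') : lobeLinkings w = lobeLinkings w' := by
  cases h with
  | relabel σ => exact (lobeLinkings_relabel σ w).symm
  | r1 u v p hp => exact (lobeLinkings_r1 hp hw').symm
  | r2_parallel u v w p q hl h hs =>
    obtain ⟨hp, hq, hs⟩ := sign_eq_neg_of_bigon h hs
    exact (lobeLinkings_r2 hl hp hq hs (.inl ⟨rfl, rfl⟩) hw').symm
  | r2_opposite u v w p q hl h hs =>
    obtain ⟨hp, hq, hs⟩ := sign_eq_neg_of_bigon h hs
    exact (lobeLinkings_r2 hl hp hq hs (.inr ⟨rfl, rfl⟩) hw').symm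
  | triangle u₀ u₁ u₂ u₃ p q r S S' t₁ t₂ t₃ hl h hS hS' ht =>
    exact lobeLinkings_triangle hl h hS hS' ht hw
  | s2_parallel u v w p c hp hc => exact lobeLinkings_s2 hp hc (.inl ⟨rfl, rfl⟩) hw
  | s2_opposite u v w p c hp hc => exact lobeLinkings_s2 hp hc (.inr ⟨rfl, rfl⟩) hw

theorem lobeLinkings_eq_of_isotopic {w w' : Word} (h : Isotopic w w') :
    lobeLinkings w = lobeLinkings w' := by
  induction h with
  | rel _ _ h => exact lobeLinkings_eq_of_step h.2.2 h.1.1 h.2.1.1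
  | refl => rfl
  | symm _ _ _ ih => exact ih.symm
  | trans _ _ _ _ _ ih ih' => exact ih.trans ih'

theorem not_isInvertible_trefoil : ¬ IsInvertible trefoil := fun h => by
  have := lobeLinkings_eq_of_isotopic h
  rw [lobeLinkings_trefoil, lobeLinkings_inverse_trefoil] at this
  exact absurd this (by decide)

/-! ### Telling Laurent polynomials apart by evaluation -/

/-- Evaluation of Laurent polynomials at the point whose coordinates are the units `x i`. -/
noncomputable def laurentEval (x : ℕ → ℚˣ) : Laurent →+* ℚ :=
  (AddMonoidAlgebra.lift ℤ ℚ (ℕ →₀ ℤ)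
    { toFun := fun v => ((v.toAdd.prod fun i n => x i ^ n : ℚˣ) : ℚ)
      map_one' := by simp
      map_mul' := fun v v' => by
        rw [← Units.val_mul, toAdd_mul, Finsupp.prod_add_index']
        · simp
        · intro i m n; exact zpow_add _ _ _ }).toRingHom

theorem laurentEval_var (x : ℕ → ℚˣ) (i : ℕ) :
    laurentEval x (laurentVar i : Laurentˣ) = x i := by
  simp only [laurentEval, laurentVar, AlgHom.toRingHom_eq_coe, RingHom.coe_coe,
    AddMonoidAlgebra.lift_single, one_smul]
  change (((Finsupp.single i (1 : ℤ)).prod fun i n => x i ^ n : ℚˣ) : ℚ) = x i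
  simp

theorem laurentEval_var_inv (x : ℕ → ℚˣ) (i : ℕ) :
    laurentEval x (((laurentVar i)⁻¹ : Laurentˣ) : Laurent) = (x i : ℚ)⁻¹ := by
  rw [← laurentEval_var x i]
  exact eq_inv_of_mul_eq_one_left (by rw [← map_mul, Units.inv_mul, map_one])

/-- The point with `A = B₁ = 2` and with all other coordinates `1`. -/
def evalPoint (i : ℕ) : ℚˣ := if i ≤ 1 then Units.mk0 2 two_ne_zero else 1

end SingularKnot

open SingularKnot in
theorem mainTheorem3 :
    let T : Word := trefoil
    let A : Laurent := varA
    let A' : Laurent := ((varA⁻¹ : Laurentˣ) : Laurent)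
    let B₁ : Laurent := varB 1
    let B₂ : Laurent := varB 2
    let B₁' : Laurent := (((varB 1)⁻¹ : Laurentˣ) : Laurent)
    let B₂' : Laurent := (((varB 2)⁻¹ : Laurentˣ) : Laurent)
    -- `T` and `-T` are diagrams of long singular knots with exactly two double points
    (IsDiagram T ∧ (doubleLabels T).length = 2 ∧
      IsDiagram (inverse T) ∧ (doubleLabels (inverse T)).length = 2) ∧
    -- the bracket of `T`, and `Vˢ` of `T`
    bracket varA varB T =
      A' ^ 6 * B₁' * B₂' + (-A ^ 4 - A' ^ 4) * B₁ * B₂' + (-A' ^ 4 - A' ^ 8) * B₁' * B₂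
        + (A ^ 6 + A ^ 2 + A' ^ 2 + A' ^ 6) * B₁ * B₂ ∧
    jones varA varB T =
      A' ^ 6 * (A' ^ 6 * B₁' * B₂' + (-A ^ 4 - A' ^ 4) * B₁ * B₂' + (-A' ^ 4 - A' ^ 8) * B₁' * B₂
        + (A ^ 6 + A ^ 2 + A' ^ 2 + A' ^ 6) * B₁ * B₂) ∧
    -- `Vˢ` of `-T` is obtained by interchanging `B₁` and `B₂`, and differs from that of `T`
    jones varA varB (inverse T) = jones varA (varB ∘ Equiv.swap 1 2) T ∧
    jones varA varB (inverse T) ≠ jones varA varB T ∧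
    -- `Δˢ` of `T` and `-T`
    alexander varA (fun i => (varB i : Laurent)) T = A' ^ 2 + (A - A') * B₁ ∧
    alexander varA (fun i => (varB i : Laurent)) (inverse T) = A' ^ 2 + (A - A') * B₂ ∧
    alexander varA (fun i => (varB i : Laurent)) (inverse T) ≠
      alexander varA (fun i => (varB i : Laurent)) T ∧
    -- `T` is not isotopic to `-T`
    ¬ IsInvertible T ∧
    -- with a single variable `B` for all double points, the polynomials of `T` and `-T` agree
    jones varA (fun _ => varB 1) (inverse T) = jones varA (fun _ => varB 1) T ∧
    alexander varA (fun _ => B₁) (inverse T) = alexander varA (fun _ => B₁) T ∧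
    -- the HOMFLY-PT polynomials of `T` and `-T` agree
    homfly (ratVar 0) (ratVar 1) (ratVar 2) (inverse T) =
      homfly (ratVar 0) (ratVar 1) (ratVar 2) T := by
  intro T A A' B₁ B₂ B₁' B₂'
  have hA : laurentEval evalPoint A = 2 := laurentEval_var ..
  have hB₁ : laurentEval evalPoint B₁ = 2 := laurentEval_var ..
  have hB₂ : laurentEval evalPoint B₂ = 1 := laurentEval_var ..
  have hA' : laurentEval evalPoint A' = 2⁻¹ := laurentEval_var_inv ..
  have hB₁' : laurentEval evalPoint B₁' = 2⁻¹ := laurentEval_var_inv ..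
  have hB₂' : laurentEval evalPoint B₂' = 1 :=
    (laurentEval_var_inv evalPoint 2).trans inv_one
  have hbr := bracket_trefoil varA varB
  -- A constant family `B` is definitionally unchanged by composition with the swap, so
  -- `jones_inverse_trefoil` also gives the one-variable equality.
  refine ⟨⟨isDiagram_trefoil, by decide, isDiagram_inverse_trefoil, by decide⟩, hbr, ?_,
    jones_inverse_trefoil varA varB, fun h => ?_, alexander_trefoil .., alexander_inverse_trefoil ..,
    fun h => ?_, not_isInvertible_trefoil, jones_inverse_trefoil varA _, ?_, ?_⟩
  · rw [jones_trefoil, hbr]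
  · rw [jones_inverse_trefoil, jones_trefoil, jones_trefoil, bracket_trefoil, bracket_trefoil] at h
    simp only [Function.comp_apply, Equiv.swap_apply_left, Equiv.swap_apply_right] at h
    replace h : A' ^ 6 * (A' ^ 6 * B₂' * B₁' + (-A ^ 4 - A' ^ 4) * B₂ * B₁' +
        (-A' ^ 4 - A' ^ 8) * B₂' * B₁ + (A ^ 6 + A ^ 2 + A' ^ 2 + A' ^ 6) * B₂ * B₁) =
      A' ^ 6 * (A' ^ 6 * B₁' * B₂' + (-A ^ 4 - A' ^ 4) * B₁ * B₂' +
        (-A' ^ 4 - A' ^ 8) * B₁' * B₂ + (A ^ 6 + A ^ 2 + A' ^ 2 + A' ^ 6) * B₁ * B₂) := h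
    -- Up to sign the two sides differ by `A⁻⁶ (A⁴ - A⁻⁸) (B₁ B₂⁻¹ - B₁⁻¹ B₂)`, which is nonzero at
    -- `A = B₁ = 2`, `B₂ = 1`.
    replace h := congrArg (laurentEval evalPoint) h
    simp only [map_add, map_sub, map_mul, map_neg, map_pow, hA, hA', hB₁, hB₂, hB₁', hB₂'] at h
    norm_num at h
  · rw [alexander_trefoil, alexander_inverse_trefoil] at h
    replace h : A' ^ 2 + (A - A') * B₂ = A' ^ 2 + (A - A') * B₁ := h
    -- The difference `(A - A⁻¹) (B₁ - B₂)` takes the value `3/2` at the same point.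
    replace h := congrArg (laurentEval evalPoint) h
    simp only [map_add, map_sub, map_mul, map_pow, hA, hA', hB₁, hB₂] at h
    norm_num at h
  · rw [alexander_trefoil, alexander_inverse_trefoil]
  · have hinj : Function.Injective (algebraMap (MvPolynomial (Fin 3) ℤ) Rat3) :=
      IsFractionRing.injective _ _
    refine homfly_inverse_trefoil _ _ _ ?_ ?_
    · exact (map_ne_zero_iff _ hinj).mpr (MvPolynomial.X_ne_zero _)
    · exact fun h => absurd (MvPolynomial.X_injective (hinj h)) (by decide)
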